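/- Let $d\ge 1$. Label the edge of the Cayley graph of the symmetric group $\mathrm{S}(d)$ (generated by all transpositions) corresponding to a transposition $(s\ t)$, $s<t$, by $t$; an $r$-step walk $\sigma,\ \sigma\tau_1,\ \dots,\ \sigma\tau_1\cdots\tau_r$ is called monotone if the labels of the transpositions $\tau_1,\dots,\tau_r$ form a weakly increasing sequence. For partitions $\alpha,\beta\vdash d$ with $\ell(\alpha)$, $\ell(\beta)$ parts and an integer $g\ge 0$, the connected monotone double Hurwitz number $\vec{H}_g(\alpha,\beta)$ of degree $d$ and genus $g$ is the number of monotone walks with $r=2g-2+\ell(\alpha)+\ell(\beta)$ steps which begin at a permutation $\sigma$ of cycle type $\alpha$, end at a permutation of cycle type $\beta$, and are such that the subgroup $\langle \sigma,\tau_1,\dots,\tau_r\rangle$ acts transitively on $\{1,\dots,d\}$. Then for every pair of integers $d\ge 1$, $g\ge 0$ with $(d,g)\neq(1,0)$ and every partition $\alpha\vdash d$, $$\sum_{\beta\vdash d}(-1)^{\ell(\beta)}\,\vec{H}_g(\alpha,\beta)=0 .$$ -/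

import Mathlib

namespace MonotoneHurwitz

/-- The number `ℓ(α)` of rows of a Young diagram `α ⊢ d`. -/
def len {d : ℕ} (α : Nat.Partition d) : ℕ := Multiset.card α.parts

/-- A walk on the Cayley graph of the symmetric group `S(d)`, generated by all transpositions, is
recorded by its initial vertex `σ` and the list of transpositions `(s t)`, `s < t`, that it
traverses, each given as the pair `(s, t)`.  These are the permutations of that list. -/
def steps {d : ℕ} (l : List (Fin d × Fin d)) : List (Equiv.Perm (Fin d)) :=
  l.map fun p => Equiv.swap p.1 p.2

/-- The final vertex of the walk which starts at `σ` and follows `l`. -/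
def endpoint {d : ℕ} (σ : Equiv.Perm (Fin d)) (l : List (Fin d × Fin d)) : Equiv.Perm (Fin d) :=
  σ * (steps l).prod

/-- `σ` has cycle type `α`, fixed points being counted as cycles of length one. -/
def HasType {d : ℕ} (σ : Equiv.Perm (Fin d)) (α : Nat.Partition d) : Prop :=
  σ.partition.parts = α.parts

/-- The monotone `r`-step walks from the conjugacy class `C_α` to the conjugacy class `C_β`:
the edge of the transposition `(s t)`, `s < t`, is labelled `t`, and the labels of the edges
traversed form a weakly increasing sequence. -/
def monotoneWalks {d : ℕ} (r : ℕ) (α β : Nat.Partition d) :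
    Set (Equiv.Perm (Fin d) × List (Fin d × Fin d)) :=
  {w | w.2.length = r ∧ (∀ p ∈ w.2, p.1 < p.2) ∧ w.2.Pairwise (fun p q => p.2 ≤ q.2) ∧
    HasType w.1 α ∧ HasType (endpoint w.1 w.2) β}

/-- The walk is connected: its initial vertex and its steps together generate a subgroup of `S(d)`
(the monodromy group of the corresponding branched cover) which acts transitively. -/
def IsConnected {d : ℕ} (w : Equiv.Perm (Fin d) × List (Fin d × Fin d)) : Prop :=
  MulAction.IsPretransitive
    (Subgroup.closure ({w.1} ∪ {τ | τ ∈ steps w.2} : Set (Equiv.Perm (Fin d)))) (Fin d)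

theorem finite_monotoneWalks {d : ℕ} (r : ℕ) (α β : Nat.Partition d) :
    (monotoneWalks r α β).Finite :=
  (Set.finite_univ.prod (List.finite_length_eq (Fin d × Fin d) r)).subset
    fun _ hw => ⟨Set.mem_univ _, hw.1⟩

/-- The connected monotone double Hurwitz number of degree `d` and genus `g`: the number of
connected monotone walks from `C_α` to `C_β` with `r = 2g - 2 + ℓ(α) + ℓ(β)` steps.  The subtraction
does not truncate for `d ≥ 1`, since then `ℓ(α), ℓ(β) ≥ 1`. -/
noncomputable def connectedHurwitz {d : ℕ} (g : ℕ) (α β : Nat.Partition d) : ℕ :=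
  {w ∈ monotoneWalks (2 * g + len α + len β - 2) α β | IsConnected w}.ncard

end MonotoneHurwitz

/-! Sign-reversing involution. Every permutation `β` is returned to the identity by exactly one walk
`ρ` with strictly decreasing labels, and `ρ` has `d - ℓ(β)` steps (`exists_isDescending`,
`IsDescending.eq_of_prod_eq`, `IsDescending.length_add_card_parts`). Appending `ρ` to a monotone
walk ending at `β` gives a closed walk of length `2g - 2 + ℓ(α) + d`, independent of `β`, and turns
the sign into `(-1)^d (-1)^|ρ|`. The result is a word with a marked break, weakly increasing before
it and strictly decreasing after it. Moving the larger letter at the break across (`moveBreak`)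
keeps the word and flips the sign. Connectedness depends only on the word (`spans_append_iff`), so
everything cancels once the word is nonempty. -/

open Equiv Equiv.Perm

namespace MonotoneHurwitz

/-! ### Cycle count under a transposition -/

section CycleCount

variable {ι : Type*} [Fintype ι] [DecidableEq ι]

theorem card_parts_partition_add_card_support (σ : Perm ι) :
    Multiset.card σ.partition.parts + σ.support.card =
      Multiset.card σ.cycleType + Fintype.card ι := by
  have := σ.support.card_le_univ
  rw [parts_partition, Multiset.card_add, Multiset.card_replicate]
  omega

/-- The product fixes `x`: a 2-cycle becomes the identity, and a longer cycle remains a cycle with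
one point fewer. -/
theorem card_cycleType_swap_mul_of_isCycle {c : Perm ι} (hc : c.IsCycle) {x : ι} (hx : c x ≠ x) :
    Multiset.card (swap x (c x) * c).cycleType + c.support.card =
      Multiset.card c.cycleType + (swap x (c x) * c).support.card + 1 := by
  by_cases h : c (c x) = x
  · have h1 : swap x (c x) * c = 1 := by
      conv_lhs => rw [hc.eq_swap_of_apply_apply_eq_self hx h, swap_apply_left]
      exact swap_mul_self _ _
    have h2 : c.support.card = 2 := by
      rw [hc.eq_swap_of_apply_apply_eq_self hx h]
      exact card_support_swap hx.symm
    rw [h1, h2, card_cycleType_eq_one.2 hc]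
    simp
  · have h1 : 0 < c.support.card := Finset.card_pos.2 ⟨x, mem_support.2 hx⟩
    rw [card_cycleType_eq_one.2 hc, card_cycleType_eq_one.2 (hc.swap_mul hx h),
      support_swap_mul_eq _ _ h, Finset.sdiff_singleton_eq_erase,
      Finset.card_erase_of_mem (mem_support.2 hx)]
    omega

/-- Splitting a moved point off its cycle increases the number of cycles by one. -/
theorem card_parts_partition_swap_mul {β : Perm ι} {x : ι} (hx : β x ≠ x) :
    Multiset.card (swap x (β x) * β).partition.parts =
      Multiset.card β.partition.parts + 1 := by
  have hmem : β.cycleOf x ∈ β.cycleFactorsFinset :=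
    cycleOf_mem_cycleFactorsFinset_iff.2 (mem_support.2 hx)
  have hdisj := (disjoint_mul_inv_of_mem_cycleFactorsFinset hmem).symm
  have hc : (β.cycleOf x).IsCycle := isCycle_cycleOf β hx
  have hcx : β.cycleOf x x = β x := cycleOf_apply_self β x
  set c := β.cycleOf x
  have hβ : β = c * (β * c⁻¹) := by rw [hdisj.commute.eq]; group
  set r := β * c⁻¹
  have hx' : c x ≠ x := by rwa [hcx]
  have hdisj' : Disjoint (swap x (c x) * c) r := by
    refine disjoint_iff_disjoint_support.2
      ((disjoint_iff_disjoint_support.1 hdisj).mono_left fun z hz => ?_)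
    exact (mem_support_swap_mul_imp_mem_support_ne hz).1
  have e : swap x (β x) * β = swap x (c x) * c * r := by rw [mul_assoc, ← hβ, hcx]
  have h1 := card_parts_partition_add_card_support β
  have h2 := card_parts_partition_add_card_support (swap x (β x) * β)
  have h3 := card_cycleType_swap_mul_of_isCycle hc hx'
  rw [e] at h2 ⊢
  rw [hdisj'.cycleType_mul, hdisj'.card_support_mul, Multiset.card_add] at h2
  have h4 : β.cycleType = c.cycleType + r.cycleType := by
    rw [← hdisj.cycleType_mul, ← hβ]
  have h5 : β.support.card = c.support.card + r.support.card := by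
    rw [← hdisj.card_support_mul, ← hβ]
  rw [h4, h5, Multiset.card_add] at h1
  omega

end CycleCount

/-! ### Factorizations with strictly decreasing labels -/

variable {d : ℕ}

/-- The steps of `ρ` are transpositions with strictly decreasing labels. -/
def IsDescending (ρ : List (Fin d × Fin d)) : Prop :=
  (∀ p ∈ ρ, p.1 < p.2) ∧ ρ.Pairwise fun p q => q.2 < p.2

theorem prod_steps_apply_of_forall_ne {ρ : List (Fin d × Fin d)} {x : Fin d}
    (h : ∀ p ∈ ρ, p.1 ≠ x ∧ p.2 ≠ x) : (steps ρ).prod x = x := by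
  induction ρ with
  | nil => simp [steps]
  | cons p ρ ih =>
    simp only [List.mem_cons, forall_eq_or_imp] at h
    have := ih h.2
    simp only [steps, List.map_cons, List.prod_cons, Perm.mul_apply] at this ⊢
    rw [this]
    exact swap_apply_of_ne_of_ne h.1.1.symm h.1.2.symm

theorem steps_cons (p : Fin d × Fin d) (ρ : List (Fin d × Fin d)) :
    steps (p :: ρ) = swap p.1 p.2 :: steps ρ := rfl

theorem steps_append (l ρ : List (Fin d × Fin d)) : steps (l ++ ρ) = steps l ++ steps ρ :=
  List.map_append

theorem IsDescending.tail {p : Fin d × Fin d} {ρ : List (Fin d × Fin d)}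
    (h : IsDescending (p :: ρ)) : IsDescending ρ :=
  ⟨fun q hq => h.1 q (List.mem_cons_of_mem _ hq), (List.pairwise_cons.1 h.2).2⟩

theorem IsDescending.prod_apply_of_lt {ρ : List (Fin d × Fin d)} (h : IsDescending ρ) {x : Fin d}
    (hx : ∀ p ∈ ρ, p.2 < x) : (steps ρ).prod x = x :=
  prod_steps_apply_of_forall_ne fun p hp =>
    ⟨((h.1 p hp).trans (hx p hp)).ne, (hx p hp).ne⟩

/-- All later labels are smaller, so only the first letter moves `p.2`. The product thus determines
that letter: `p.2` is the largest moved point and `p.1` its image. -/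
theorem IsDescending.prod_cons_apply {p : Fin d × Fin d} {ρ : List (Fin d × Fin d)}
    (h : IsDescending (p :: ρ)) : (steps (p :: ρ)).prod p.2 = p.1 := by
  rw [steps_cons, List.prod_cons, Perm.mul_apply,
    h.tail.prod_apply_of_lt (List.pairwise_cons.1 h.2).1, swap_apply_right]

theorem IsDescending.prod_cons_apply_of_lt {p : Fin d × Fin d} {ρ : List (Fin d × Fin d)}
    (h : IsDescending (p :: ρ)) {x : Fin d} (hx : p.2 < x) : (steps (p :: ρ)).prod x = x := by
  refine h.prod_apply_of_lt fun q hq => ?_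
  rcases List.mem_cons.1 hq with rfl | hq
  · exact hx
  · exact ((List.pairwise_cons.1 h.2).1 q hq).trans hx

theorem IsDescending.label_le {p q : Fin d × Fin d} {ρ ρ' : List (Fin d × Fin d)}
    (h : IsDescending (p :: ρ)) (h' : IsDescending (q :: ρ'))
    (e : (steps (p :: ρ)).prod = (steps (q :: ρ')).prod) : p.2 ≤ q.2 := by
  by_contra! hlt
  have h1 := h.prod_cons_apply
  rw [e, h'.prod_cons_apply_of_lt hlt] at h1
  exact (h.1 p (by simp)).ne h1.symm

theorem IsDescending.prod_cons_ne_one {p : Fin d × Fin d} {ρ : List (Fin d × Fin d)}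
    (h : IsDescending (p :: ρ)) : (steps (p :: ρ)).prod ≠ 1 := fun e => by
  have h1 := h.prod_cons_apply
  rw [e, Perm.one_apply] at h1
  exact (h.1 p (by simp)).ne h1.symm

/-- A permutation has at most one factorization with strictly decreasing labels. -/
theorem IsDescending.eq_of_prod_eq {ρ ρ' : List (Fin d × Fin d)} (h : IsDescending ρ)
    (h' : IsDescending ρ') (e : (steps ρ).prod = (steps ρ').prod) : ρ = ρ' := by
  induction ρ generalizing ρ' with
  | nil =>
    cases ρ' with
    | nil => rfl
    | cons q ρ' => exact absurd e.symm h'.prod_cons_ne_one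
  | cons p ρ ih =>
    cases ρ' with
    | nil => exact absurd e h.prod_cons_ne_one
    | cons q ρ' =>
      have h2 : p.2 = q.2 := le_antisymm (h.label_le h' e) (h'.label_le h e.symm)
      have h1 : p.1 = q.1 := by rw [← h.prod_cons_apply, ← h'.prod_cons_apply, e, h2]
      obtain rfl : p = q := Prod.ext h1 h2
      rw [steps_cons, steps_cons, List.prod_cons, List.prod_cons] at e
      rw [ih h.tail h'.tail (mul_left_cancel e)]

/-- A factorization with strictly decreasing labels is minimal: it splits off one cycle of `β` at a
time. -/
theorem IsDescending.length_add_card_parts {ρ : List (Fin d × Fin d)} (h : IsDescending ρ)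
    {β : Perm (Fin d)} (e : β * (steps ρ).prod = 1) :
    ρ.length + Multiset.card β.partition.parts = d := by
  induction ρ generalizing β with
  | nil =>
    obtain rfl : β = 1 := by simpa [steps] using e
    simp [parts_partition]
  | cons p ρ ih =>
    have hp := h.1 p (by simp)
    have hβ : β p.1 = p.2 := by
      rw [← h.prod_cons_apply, ← Perm.mul_apply, e, Perm.one_apply]
    have e' : β * swap p.1 p.2 * (steps ρ).prod = 1 := by
      rwa [steps_cons, List.prod_cons, ← mul_assoc] at e
    -- Carried across `β`, the transposition takes the form that splits `p.2` off its cycle.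
    have hs : β * swap p.1 p.2 = swap p.2 (β p.2) * β := by
      rw [mul_swap_eq_swap_mul, hβ]
    have hne : β p.2 ≠ p.2 := fun h2 => hp.ne (β.injective (hβ.trans h2.symm))
    have h1 := ih h.tail e'
    rw [hs, card_parts_partition_swap_mul hne] at h1
    rw [List.length_cons]
    omega

theorem rel_swap_apply {R : Setoid (Fin d)} {s t : Fin d} (h : R s t) (x : Fin d) :
    R x (swap s t x) := by
  by_cases h1 : x = s
  · rwa [h1, swap_apply_left]
  by_cases h2 : x = t
  · rw [h2, swap_apply_right]
    exact R.symm h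
  rw [swap_apply_of_ne_of_ne h1 h2]

/-- The steps of a factorization with strictly decreasing labels of `β⁻¹` stay within the cycles of
`β`. -/
theorem IsDescending.rel_of_forall_rel {ρ : List (Fin d × Fin d)} (h : IsDescending ρ)
    {β : Perm (Fin d)} (e : β * (steps ρ).prod = 1) (R : Setoid (Fin d))
    (hR : ∀ x, R x (β x)) : ∀ p ∈ ρ, R p.1 p.2 := by
  induction ρ generalizing β with
  | nil => simp
  | cons p ρ ih =>
    have hβ : β p.1 = p.2 := by
      rw [← h.prod_cons_apply, ← Perm.mul_apply, e, Perm.one_apply]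
    have hp : R p.1 p.2 := hβ ▸ hR p.1
    have e' : β * swap p.1 p.2 * (steps ρ).prod = 1 := by
      rwa [steps_cons, List.prod_cons, ← mul_assoc] at e
    have := ih h.tail e' fun x => by
      rw [Perm.mul_apply]
      exact R.trans (rel_swap_apply hp x) (hR _)
    simpa [hp] using this

/-- Every permutation has a factorization with strictly decreasing labels. -/
theorem exists_isDescending (β : Perm (Fin d)) :
    ∃ ρ, IsDescending ρ ∧ β * (steps ρ).prod = 1 := by
  -- The bound on the labels is carried along so that a letter with label `k` can be put in front.
  suffices H : ∀ k : ℕ, ∀ β : Perm (Fin d), (∀ x : Fin d, k ≤ x.val → β x = x) →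
      ∃ ρ, IsDescending ρ ∧ (∀ p ∈ ρ, p.2.val < k) ∧ β * (steps ρ).prod = 1 by
    obtain ⟨ρ, h1, -, h2⟩ := H d β fun x hx => absurd x.isLt (by omega)
    exact ⟨ρ, h1, h2⟩
  intro k
  induction k with
  | zero =>
    intro β hβ
    refine ⟨[], by simp [IsDescending], by simp, ?_⟩
    ext x
    simp [steps, hβ]
  | succ k ih =>
    intro β hβ
    by_cases hfix : ∀ x : Fin d, k ≤ x.val → β x = x
    · obtain ⟨ρ, h1, h2, h3⟩ := ih β hfix
      exact ⟨ρ, h1, fun p hp => (h2 p hp).trans (Nat.lt_succ_self k), h3⟩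
    · push Not at hfix
      obtain ⟨t, hkt, ht⟩ := hfix
      have htk : t.val = k := by
        by_contra hne
        exact ht (hβ t (by omega))
      -- As `t` is the largest moved point, its preimage `s` lies below it, and `β * swap s t` fixes
      -- `t`.
      set s := β.symm t
      have hst : β s = t := β.apply_symm_apply t
      have hlt : s < t := by
        by_contra! hle
        rcases hle.eq_or_lt with h | h
        · exact ht (by rwa [← h] at hst)
        · have := hβ s (by rw [Fin.lt_def] at h; omega)
          rw [hst] at this
          exact h.ne this
      obtain ⟨ρ, h1, h2, h3⟩ := ih (β * swap s t) fun x hx => by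
        rw [Perm.mul_apply]
        by_cases hxt : x = t
        · rw [hxt, swap_apply_right, hst]
        · have hxk : k < x.val := by
            rcases hx.eq_or_lt with h | h
            · exact absurd (Fin.ext (by omega)) hxt
            · exact h
          have hxs : x ≠ s := by
            rintro h
            rw [Fin.lt_def, ← h] at hlt
            omega
          rw [swap_apply_of_ne_of_ne hxs hxt, hβ x hxk]
      refine ⟨(s, t) :: ρ, ⟨?_, ?_⟩, ?_, ?_⟩
      · exact List.forall_mem_cons.2 ⟨hlt, h1.1⟩
      · refine List.pairwise_cons.2 ⟨fun p hp => ?_, h1.2⟩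
        have := h2 p hp
        rw [Fin.lt_def]
        simpa [htk] using this
      · simp only [List.mem_cons, forall_eq_or_imp]
        exact ⟨by omega, fun p hp => (h2 p hp).trans (Nat.lt_succ_self k)⟩
      · rwa [steps_cons, List.prod_cons, ← mul_assoc]

/-! ### Connectedness through equivalence relations -/

/-- Every equivalence relation that is compatible with `σ` and with the steps of `l` is total. -/
def Spans (σ : Perm (Fin d)) (l : List (Fin d × Fin d)) : Prop :=
  ∀ R : Setoid (Fin d), (∀ x, R x (σ x)) → (∀ p ∈ l, R p.1 p.2) → ∀ x y, R x y

/-- The permutations all of whose cycles are contained in classes of `R`. -/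
def stabilizerOfSetoid (R : Setoid (Fin d)) : Subgroup (Perm (Fin d)) where
  carrier := {g | ∀ x, R x (g x)}
  one_mem' x := R.refl x
  mul_mem' {g h} hg hh x := R.trans (hh x) (hg (h x))
  inv_mem' {g} hg x := by
    have := hg (g⁻¹ x)
    rw [← Perm.mul_apply, mul_inv_cancel, Perm.one_apply] at this
    exact R.symm this

/-- Permutations preserving each class of `R` form a subgroup, which contains the generators;
conversely, take `R` to be the orbit relation. -/
theorem isConnected_iff_spans (w : Perm (Fin d) × List (Fin d × Fin d)) :
    IsConnected w ↔ Spans w.1 w.2 := by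
  constructor
  · intro h R h1 h2 x y
    have hle : Subgroup.closure ({w.1} ∪ {τ | τ ∈ steps w.2} : Set (Perm (Fin d))) ≤
        stabilizerOfSetoid R := by
      refine (Subgroup.closure_le _).2 (Set.union_subset (Set.singleton_subset_iff.2 h1) ?_)
      intro τ hτ
      obtain ⟨p, hp, rfl⟩ := List.mem_map.1 hτ
      exact rel_swap_apply (h2 p hp)
    obtain ⟨g, rfl⟩ := h.exists_smul_eq x y
    exact hle g.2 x
  · intro h
    refine ⟨fun x y => ?_⟩
    refine h (MulAction.orbitRel (Subgroup.closure
      ({w.1} ∪ {τ | τ ∈ steps w.2} : Set (Perm (Fin d)))) (Fin d)) (fun z => ?_)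
      (fun p hp => ?_) y x
    · exact Setoid.symm' _ ⟨⟨w.1, Subgroup.subset_closure (by simp)⟩, rfl⟩
    · refine ⟨⟨swap p.1 p.2, Subgroup.subset_closure (Or.inr (List.mem_map.2 ⟨p, hp, rfl⟩))⟩, ?_⟩
      exact swap_apply_right _ _

/-- The letters of `ρ` stay within cycles of the endpoint of `l`, a product of `σ` and steps of `l`,
so they join no new points. -/
theorem spans_append_iff {σ : Perm (Fin d)} {l ρ : List (Fin d × Fin d)} (hρ : IsDescending ρ)
    (e : σ * (steps (l ++ ρ)).prod = 1) : Spans σ (l ++ ρ) ↔ Spans σ l := by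
  refine ⟨fun h R h1 h2 => h R h1 fun p hp => ?_, fun h R h1 h2 =>
    h R h1 fun p hp => h2 p (List.mem_append_left _ hp)⟩
  rcases List.mem_append.1 hp with hp | hp
  · exact h2 p hp
  · rw [steps_append, List.prod_append, ← mul_assoc] at e
    have hσ : σ ∈ stabilizerOfSetoid R := h1
    have hl : (steps l).prod ∈ stabilizerOfSetoid R := list_prod_mem fun τ hτ => by
      obtain ⟨q, hq, rfl⟩ := List.mem_map.1 hτ
      exact rel_swap_apply (h2 q hq)
    exact hρ.rel_of_forall_rel e R (mul_mem hσ hl) p hp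

/-! ### The involution on words with a break -/

/-- A word `u.reverse ++ ρ` with a marked break is recorded as the pair `(u, ρ)`.  The letter next
to the break with the larger label is moved across; in case of a tie it is the right one. -/
def moveBreak : List (Fin d × Fin d) × List (Fin d × Fin d) →
    List (Fin d × Fin d) × List (Fin d × Fin d)
  | ([], []) => ([], [])
  | ([], b :: ρ) => ([b], ρ)
  | (a :: u, []) => (u, [a])
  | (a :: u, b :: ρ) => if a.2 ≤ b.2 then (b :: a :: u, ρ) else (u, a :: b :: ρ)

/-- The labels increase weakly up to the break and decrease strictly after it. -/
def IsUnimodal (z : List (Fin d × Fin d) × List (Fin d × Fin d)) : Prop :=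
  (z.1.Pairwise fun p q => q.2 ≤ p.2) ∧ z.2.Pairwise fun p q => q.2 < p.2

def word (z : List (Fin d × Fin d) × List (Fin d × Fin d)) : List (Fin d × Fin d) :=
  z.1.reverse ++ z.2

theorem word_moveBreak (z : List (Fin d × Fin d) × List (Fin d × Fin d)) :
    word (moveBreak z) = word z := by
  obtain ⟨_ | ⟨a, u⟩, _ | ⟨b, ρ⟩⟩ := z <;> simp only [moveBreak, word]
  · simp
  · simp
  · split_ifs <;> simp

theorem neg_one_pow_moveBreak {z : List (Fin d × Fin d) × List (Fin d × Fin d)}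
    (hz : word z ≠ []) : (-1 : ℤ) ^ z.2.length + (-1) ^ (moveBreak z).2.length = 0 := by
  obtain ⟨_ | ⟨a, u⟩, _ | ⟨b, ρ⟩⟩ := z <;> simp only [moveBreak]
  · simp [word] at hz
  · simp [pow_succ]
  · simp
  · split_ifs <;> simp [pow_succ]

theorem IsUnimodal.moveBreak {z : List (Fin d × Fin d) × List (Fin d × Fin d)}
    (hz : IsUnimodal z) : IsUnimodal (moveBreak z) := by
  obtain ⟨_ | ⟨a, u⟩, _ | ⟨b, ρ⟩⟩ := z <;> simp only [MonotoneHurwitz.moveBreak]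
  · exact hz
  · exact ⟨List.pairwise_singleton _ _, (List.pairwise_cons.1 hz.2).2⟩
  · exact ⟨(List.pairwise_cons.1 hz.1).2, List.pairwise_singleton _ _⟩
  · obtain ⟨h1, h2⟩ := hz
    simp only at h1 h2
    split_ifs with hab
    · refine ⟨List.pairwise_cons.2 ⟨List.forall_mem_cons.2 ⟨hab, fun q hq => ?_⟩, h1⟩,
        (List.pairwise_cons.1 h2).2⟩
      exact ((List.pairwise_cons.1 h1).1 q hq).trans hab
    · rw [not_le] at hab
      refine ⟨(List.pairwise_cons.1 h1).2,
        List.pairwise_cons.2 ⟨List.forall_mem_cons.2 ⟨hab, fun q hq => ?_⟩, h2⟩⟩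
      exact ((List.pairwise_cons.1 h2).1 q hq).trans hab

/-- A letter moved left is strictly above the next one on the right; a letter moved right is weakly
above the next one on the left. The tie rule sends it back in both cases. -/
theorem IsUnimodal.moveBreak_moveBreak {z : List (Fin d × Fin d) × List (Fin d × Fin d)}
    (hz : IsUnimodal z) : MonotoneHurwitz.moveBreak (MonotoneHurwitz.moveBreak z) = z := by
  obtain ⟨u, ρ⟩ := z
  obtain ⟨h1, h2⟩ := hz
  rcases u with _ | ⟨a, _ | ⟨a', u⟩⟩ <;> rcases ρ with _ | ⟨b, _ | ⟨b', ρ⟩⟩ <;>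
    simp_all [MonotoneHurwitz.moveBreak] <;> split_ifs <;>
    simp_all

/-- The monotone walks of total length `n` that continue from their endpoint to the identity with
strictly decreasing labels. -/
def closedWalks (n : ℕ) (α : Nat.Partition d) :
    Set (Perm (Fin d) × List (Fin d × Fin d) × List (Fin d × Fin d)) :=
  {z | HasType z.1 α ∧ (word z.2).length = n ∧ (∀ p ∈ word z.2, p.1 < p.2) ∧ IsUnimodal z.2 ∧
    z.1 * (steps (word z.2)).prod = 1 ∧ Spans z.1 (word z.2)}

theorem finite_closedWalks (n : ℕ) (α : Nat.Partition d) : (closedWalks n α).Finite := by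
  refine (Set.finite_univ.prod ((List.finite_length_le (Fin d × Fin d) n).prod
    (List.finite_length_le (Fin d × Fin d) n))).subset fun z hz => ?_
  have := hz.2.1
  simp only [word, List.length_append, List.length_reverse] at this
  refine ⟨Set.mem_univ _, ?_, ?_⟩ <;> simp only [Set.mem_ofPred_eq] <;> omega

theorem sum_closedWalks_eq_zero {n : ℕ} (hn : n ≠ 0) (α : Nat.Partition d) :
    ∑ z ∈ (finite_closedWalks n α).toFinset, (-1 : ℤ) ^ z.2.2.length = 0 := by
  have key : ∀ z ∈ (finite_closedWalks n α).toFinset,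
      (-1 : ℤ) ^ z.2.2.length + (-1) ^ (moveBreak z.2).2.length = 0 := fun z hz => by
    refine neg_one_pow_moveBreak fun h => hn ?_
    rw [← ((Set.Finite.mem_toFinset _).1 hz).2.1, h, List.length_nil]
  refine Finset.sum_involution (fun z _ => (z.1, moveBreak z.2)) key ?_ ?_ ?_
  · intro z hz h0 h
    have := key z hz
    rw [show moveBreak z.2 = z.2 from congrArg Prod.snd h] at this
    omega
  · intro z hz
    rw [Set.Finite.mem_toFinset] at hz ⊢
    obtain ⟨h1, h2, h3, h4, h5, h6⟩ := hz
    refine ⟨h1, ?_, ?_, h4.moveBreak, ?_, ?_⟩ <;> simpa only [word_moveBreak]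
  · intro z hz
    rw [Set.Finite.mem_toFinset] at hz
    exact Prod.ext rfl hz.2.2.2.1.moveBreak_moveBreak

/-! ### Monotone walks as closed walks -/

/-- The cycle type of a permutation as a partition of `d`. -/
def typeOf (σ : Perm (Fin d)) : Nat.Partition d where
  parts := σ.partition.parts
  parts_pos := σ.partition.parts_pos
  parts_sum := σ.partition.parts_sum.trans (Fintype.card_fin d)

theorem hasType_iff {σ : Perm (Fin d)} {α : Nat.Partition d} : HasType σ α ↔ typeOf σ = α :=
  ⟨fun h => Nat.Partition.ext h, fun h => h ▸ rfl⟩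

theorem len_pos (hd : 1 ≤ d) (α : Nat.Partition d) : 1 ≤ len α := by
  by_contra! h
  have := α.parts_sum
  rw [Multiset.card_eq_zero.1 (Nat.lt_one_iff.1 h)] at this
  simp at this
  omega

/-- The connected monotone walks from `C_α` to `C_β` of genus `g`. -/
def connectedWalks (g : ℕ) (α β : Nat.Partition d) :
    Set (Perm (Fin d) × List (Fin d × Fin d)) :=
  {w ∈ monotoneWalks (2 * g + len α + len β - 2) α β | IsConnected w}

theorem finite_connectedWalks (g : ℕ) (α β : Nat.Partition d) : (connectedWalks g α β).Finite :=
  (finite_monotoneWalks _ α β).subset (Set.sep_subset _ _)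

theorem mul_prod_word (σ : Perm (Fin d)) (u ρ : List (Fin d × Fin d)) :
    σ * (steps (word (u, ρ))).prod = endpoint σ u.reverse * (steps ρ).prod := by
  rw [word, steps_append, List.prod_append, ← mul_assoc, endpoint]

theorem mem_closedWalks_iff (hd : 1 ≤ d) {g : ℕ} {α : Nat.Partition d} {σ : Perm (Fin d)}
    {u ρ : List (Fin d × Fin d)} (hρ : IsDescending ρ)
    (e : endpoint σ u.reverse * (steps ρ).prod = 1) :
    (σ, u, ρ) ∈ closedWalks (2 * g + len α + d - 2) α ↔
      (σ, u.reverse) ∈ connectedWalks g α (typeOf (endpoint σ u.reverse)) := by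
  have hl : ρ.length + len (typeOf (endpoint σ u.reverse)) = d := hρ.length_add_card_parts e
  -- Positivity keeps both subtractions of 2 from truncating.
  have h1 := len_pos hd α
  have h2 := len_pos hd (typeOf (endpoint σ u.reverse))
  have hlen : (word (u, ρ)).length = 2 * g + len α + d - 2 ↔
      u.reverse.length = 2 * g + len α + len (typeOf (endpoint σ u.reverse)) - 2 := by
    rw [word, List.length_append]
    simp only
    omega
  have hspan := spans_append_iff (l := u.reverse) hρ (by rw [← mul_prod_word, word] at e; exact e)
  have hval : (∀ p ∈ word (u, ρ), p.1 < p.2) ↔ ∀ p ∈ u.reverse, p.1 < p.2 :=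
    ⟨fun h p hp => h p (List.mem_append_left _ hp), fun h p hp =>
      (List.mem_append.1 hp).elim (h p) (hρ.1 p)⟩
  have huni : IsUnimodal (u, ρ) ↔ u.reverse.Pairwise fun p q => p.2 ≤ q.2 := by
    rw [List.pairwise_reverse]
    exact ⟨fun h => h.1, fun h => ⟨h, hρ.2⟩⟩
  simp only [closedWalks, connectedWalks, monotoneWalks, Set.mem_ofPred_eq, hlen, hval, huni,
    mul_prod_word, e, isConnected_iff_spans, hasType_iff]
  rw [word, hspan]
  tauto

/-- Forgetting `ρ` is a bijection onto the connected monotone walks, since the endpoint determines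
`ρ`. -/
theorem sum_connectedHurwitz_eq (hd : 1 ≤ d) (g : ℕ) (α : Nat.Partition d) :
    ∑ β : Nat.Partition d, (-1 : ℤ) ^ len β * (connectedHurwitz g α β : ℤ) =
      (-1) ^ d * ∑ z ∈ (finite_closedWalks (2 * g + len α + d - 2) α).toFinset,
        (-1 : ℤ) ^ z.2.2.length := by
  have h1 : ∀ β : Nat.Partition d, (-1 : ℤ) ^ len β * (connectedHurwitz g α β : ℤ) =
      ∑ w ∈ (finite_connectedWalks g α β).toFinset, (-1 : ℤ) ^ len β := fun β => by
    rw [Finset.sum_const, nsmul_eq_mul, mul_comm, ← Set.ncard_eq_toFinset_card _ (finite_connectedWalks g α β)]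
    rfl
  have hdata : ∀ z ∈ closedWalks (2 * g + len α + d - 2) α,
      IsDescending z.2.2 ∧ endpoint z.1 z.2.1.reverse * (steps z.2.2).prod = 1 := fun z hz =>
    ⟨⟨fun p hp => hz.2.2.1 p (List.mem_append_right _ hp), hz.2.2.2.1.2⟩, by
      rw [← mul_prod_word]; exact hz.2.2.2.2.1⟩
  rw [Finset.sum_congr rfl fun β _ => h1 β, Finset.sum_sigma', Finset.mul_sum]
  symm
  refine Finset.sum_bij (fun z _ => ⟨typeOf (endpoint z.1 z.2.1.reverse), (z.1, z.2.1.reverse)⟩)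
    ?_ ?_ ?_ ?_
  · intro z hz
    rw [Set.Finite.mem_toFinset] at hz
    obtain ⟨hρ, e⟩ := hdata z hz
    simpa using (mem_closedWalks_iff hd hρ e).1 hz
  · rintro ⟨σ, u, ρ⟩ hz ⟨σ', u', ρ'⟩ hz' h
    rw [Set.Finite.mem_toFinset] at hz hz'
    obtain ⟨hρ, e⟩ := hdata _ hz
    obtain ⟨hρ', e'⟩ := hdata _ hz'
    simp only [Sigma.mk.injEq, heq_eq_eq, Prod.mk.injEq, List.reverse_inj] at h e e' hρ hρ'
    obtain ⟨-, rfl, rfl⟩ := h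
    rw [hρ.eq_of_prod_eq hρ' (mul_left_cancel (e.trans e'.symm))]
  · rintro ⟨β, σ, l⟩ hw
    simp only [Finset.mem_sigma, Finset.mem_univ, true_and, Set.Finite.mem_toFinset] at hw
    obtain rfl : typeOf (endpoint σ l) = β := hasType_iff.1 hw.1.2.2.2.2
    obtain ⟨ρ, hρ, e⟩ := exists_isDescending (endpoint σ l)
    refine ⟨(σ, l.reverse, ρ), ?_, by simp only [List.reverse_reverse]⟩
    rw [Set.Finite.mem_toFinset, mem_closedWalks_iff hd hρ (by rwa [List.reverse_reverse]),
      List.reverse_reverse]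
    exact hw
  · intro z hz
    rw [Set.Finite.mem_toFinset] at hz
    obtain ⟨hρ, e⟩ := hdata z hz
    have hl : z.2.2.length + len (typeOf (endpoint z.1 z.2.1.reverse)) = d :=
      hρ.length_add_card_parts e
    have hpow := congrArg (fun k => (-1 : ℤ) ^ k) hl
    simp only [pow_add] at hpow
    rw [← hpow, mul_right_comm, ← pow_add, Even.neg_one_pow ⟨_, rfl⟩, one_mul]

end MonotoneHurwitz

theorem mainTheorem3 (d g : ℕ) (hd : 1 ≤ d) (hdg : (d, g) ≠ (1, 0)) (α : Nat.Partition d) :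
    ∑ β : Nat.Partition d,
      (-1 : ℤ) ^ MonotoneHurwitz.len β * (MonotoneHurwitz.connectedHurwitz g α β : ℤ) = 0 := by
  have hα := MonotoneHurwitz.len_pos hd α
  -- Length zero forces `d = 1` and `g = 0`, where the empty word has no partner.
  have hn : 2 * g + MonotoneHurwitz.len α + d - 2 ≠ 0 := fun h => hdg <| by
    rw [Prod.mk.injEq]
    omega
  rw [MonotoneHurwitz.sum_connectedHurwitz_eq hd, MonotoneHurwitz.sum_closedWalks_eq_zero hn,
    mul_zero]
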